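/- Let $K$ be a field and let $E=(E^0,E^1,r,s)$ be a finite directed graph (that is, $E^0$ and $E^1$ are finite; loops and parallel edges are allowed). A path of positive length is a sequence $p=e_1\cdots e_n$ ($n\ge 1$) of edges with $r(e_i)=s(e_{i+1})$ for $1\le i<n$. It is a cycle if $s(e_1)=r(e_n)$ and $s(e_i)\neq s(e_j)$ for all $i\neq j$. An edge $e$ is an exit of $p$ if $s(e)=s(e_i)$ and $e\neq e_i$ for some $i$. Assume that $E$ is a no-exit graph, i.e. that no cycle of $E$ has an exit. Let $L_K(E)$ be the Leavitt path algebra of $E$ over $K$: the free associative $K$-algebra on the vertices $v\in E^0$, the edges $e\in E^1$ and the ghost edges $e^*$ ($e\in E^1$), modulo the relations - $vv=v$, and $vw=0$ for distinct vertices $v,w$; - $s(e)e=e=e\,r(e)$ and $r(e)e^*=e^*=e^*s(e)$ for every edge $e$; - $e^*e=r(e)$, and $e^*f=0$ for distinct edges $e,f$; - $v=\sum_{e\in E^1,\ s(e)=v}ee^*$ for every vertex $v$ with $0<|s^{-1}(v)|<\infty$. Then $L_K(E)$ is a Baer ring: for every subset $S\subseteq L_K(E)$, the right annihilator $\{x :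 ax=0 \text{ for all } a\in S\}$ equals $eL_K(E)$ for some idempotent $e\in L_K(E)$, and the left annihilator $\{x : xa=0\text{ for all }a\in S\}$ equals $L_K(E)e'$ for some idempotent $e'\in L_K(E)$. -/

import Mathlib

universe u v w

/-- A directed graph `(E⁰, E¹, r, s)`: vertices, edges, and source and range maps.
Loops and parallel edges are allowed, and both sets are arbitrary. -/
structure DirectedMultigraph where
  /-- the set of vertices -/
  Vertex : Type u
  /-- the set of edges -/
  Edge : Type v
  /-- the source of an edge -/
  source : Edge → Vertex
  /-- the range of an edge -/
  range : Edge → Vertex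

namespace DirectedMultigraph

variable (E : DirectedMultigraph.{u, v})

/-- A graph is finite if it has finitely many vertices and finitely many edges. -/
def IsFinite : Prop :=
  Finite E.Vertex ∧ Finite E.Edge

/-- `p = e₁ ⋯ eₙ` is a path of positive length: `n ≥ 1` and `r(eᵢ) = s(eᵢ₊₁)`. -/
def IsPath (p : List E.Edge) : Prop :=
  p ≠ [] ∧ p.IsChain (fun e f => E.range e = E.source f)

/-- A closed path: a path `p = e₁ ⋯ eₙ` of positive length with `s(e₁) = r(eₙ)`. -/
def IsClosedPath (p : List E.Edge) : Prop :=
  E.IsPath p ∧ ∀ hp : p ≠ [], E.source (p.head hp) = E.range (p.getLast hp)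

/-- A cycle: a closed path whose edges have pairwise distinct sources. -/
def IsCycle (p : List E.Edge) : Prop :=
  E.IsClosedPath p ∧ (p.map E.source).Nodup

/-- The edge `e` is an exit of the path `p = e₁ ⋯ eₙ` if, for some `i`,
`s(e) = s(eᵢ)` and `e ≠ eᵢ`. -/
def IsExit (e : E.Edge) (p : List E.Edge) : Prop :=
  ∃ f ∈ p, E.source e = E.source f ∧ e ≠ f

/-- A no-exit graph: no cycle has an exit. -/
def IsNoExit : Prop :=
  ∀ p : List E.Edge, E.IsCycle p → ∀ e : E.Edge, ¬ E.IsExit e p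

end DirectedMultigraph

namespace LeavittPath

/-- The generators of the Leavitt path algebra: vertices, edges and ghost edges `e*`. -/
inductive Generator (E : DirectedMultigraph.{u, v}) : Type (max u v)
  | vertex (x : E.Vertex) : Generator E
  | edge (e : E.Edge) : Generator E
  | ghost (e : E.Edge) : Generator E

/-- The free associative (not necessarily unital) `K`-algebra on the vertices, edges and ghost
edges: its basis consists of the nonempty words in the generators. -/
abbrev FreeAlg (K : Type w) [Field K] (E : DirectedMultigraph.{u, v}) : Type (max u v w) :=
  MonoidAlgebra K (FreeSemigroup (Generator E))

variable (K : Type w) [Field K] (E : DirectedMultigraph.{u, v})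

/-- A generator as an element of the free algebra. -/
noncomputable def gen (g : Generator E) : FreeAlg K E :=
  MonoidAlgebra.single (FreeSemigroup.of g) (1 : K)

/-- A vertex as an element of the free algebra. -/
noncomputable abbrev vert (x : E.Vertex) : FreeAlg K E := gen K E (Generator.vertex x)

/-- An edge as an element of the free algebra. -/
noncomputable abbrev edg (e : E.Edge) : FreeAlg K E := gen K E (Generator.edge e)

/-- The ghost edge `e*` as an element of the free algebra. -/
noncomputable abbrev gho (e : E.Edge) : FreeAlg K E := gen K E (Generator.ghost e)

/-- The defining relations of the Leavitt path algebra. The last constructor makes the relation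
stable under scalars, so that the ring congruence generated by it is a congruence
of `K`-algebras although the algebra need not have a unit. -/
inductive Rel : FreeAlg K E → FreeAlg K E → Prop
  /-- (P1): `v v = v` -/
  | vertex_mul_self (x : E.Vertex) : Rel (vert K E x * vert K E x) (vert K E x)
  /-- (P1): `v w = 0` for `v ≠ w` -/
  | vertex_mul_of_ne (x y : E.Vertex) (h : x ≠ y) : Rel (vert K E x * vert K E y) 0
  /-- (P2): `s(e) e = e` -/
  | source_mul_edge (e : E.Edge) : Rel (vert K E (E.source e) * edg K E e) (edg K E e)
  /-- (P2): `e r(e) = e` -/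
  | edge_mul_range (e : E.Edge) : Rel (edg K E e * vert K E (E.range e)) (edg K E e)
  /-- (P2) for ghost edges: `r(e) e* = e*` -/
  | range_mul_ghost (e : E.Edge) : Rel (vert K E (E.range e) * gho K E e) (gho K E e)
  /-- (P2) for ghost edges: `e* s(e) = e*` -/
  | ghost_mul_source (e : E.Edge) : Rel (gho K E e * vert K E (E.source e)) (gho K E e)
  /-- (CK1): `e* e = r(e)` -/
  | ghost_mul_self (e : E.Edge) : Rel (gho K E e * edg K E e) (vert K E (E.range e))
  /-- (CK1): `e* f = 0` for `e ≠ f` -/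
  | ghost_mul_of_ne (e f : E.Edge) (h : e ≠ f) : Rel (gho K E e * edg K E f) 0
  /-- (CK2): `v = ∑ e e*`, the sum over all edges `e` with source `v`, for every vertex `v`
  that emits at least one and only finitely many edges -/
  | vertex_eq_sum (x : E.Vertex) (hfin : {e : E.Edge | E.source e = x}.Finite)
      (hne : {e : E.Edge | E.source e = x}.Nonempty) :
      Rel (vert K E x) (∑ e ∈ hfin.toFinset, edg K E e * gho K E e)
  | smul (k : K) {a b : FreeAlg K E} (h : Rel a b) : Rel (k • a) (k • b)

/-- The congruence on the free algebra generated by the defining relations. -/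
noncomputable def congruence : RingCon (FreeAlg K E) := ringConGen (Rel K E)

theorem congruence_smul (k : K) {a b : FreeAlg K E} (h : congruence K E a b) :
    congruence K E (k • a) (k • b) := by
  change RingConGen.Rel (Rel K E) _ _
  change RingConGen.Rel (Rel K E) _ _ at h
  induction h with
  | of _ _ h => exact .of _ _ (.smul k h)
  | refl _ => exact .refl _
  | symm _ ih => exact .symm ih
  | trans _ _ ih₁ ih₂ => exact .trans ih₁ ih₂
  | add _ _ ih₁ ih₂ => rw [smul_add, smul_add]; exact .add ih₁ ih₂
  | mul _ h₂ ih₁ _ => rw [← smul_mul_assoc, ← smul_mul_assoc]; exact .mul ih₁ h₂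

end LeavittPath

/-- The Leavitt path algebra `L_K(E)` of a directed graph `E` over a field `K`: the free
associative `K`-algebra on the vertices, edges and ghost edges, modulo the relations (P1), (P2),
(CK1) and (CK2). It is unital exactly when `E` has finitely many vertices. -/
def LeavittPathAlgebra (K : Type w) [Field K] (E : DirectedMultigraph.{u, v}) :
    Type (max u v w) :=
  (LeavittPath.congruence K E).Quotient

namespace LeavittPathAlgebra

variable (K : Type w) [Field K] (E : DirectedMultigraph.{u, v})

noncomputable instance : NonUnitalRing (LeavittPathAlgebra K E) :=
  inferInstanceAs (NonUnitalRing (LeavittPath.congruence K E).Quotient)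

/-- The quotient map from the free algebra. -/
noncomputable def mk (a : LeavittPath.FreeAlg K E) : LeavittPathAlgebra K E :=
  (LeavittPath.congruence K E).toQuotient a

theorem mk_surjective : Function.Surjective (mk K E) :=
  fun x => Quotient.inductionOn' x fun a => ⟨a, rfl⟩

theorem mk_add (a b : LeavittPath.FreeAlg K E) : mk K E (a + b) = mk K E a + mk K E b := rfl

theorem mk_mul (a b : LeavittPath.FreeAlg K E) : mk K E (a * b) = mk K E a * mk K E b := rfl

theorem mk_zero : mk K E 0 = 0 := rfl

noncomputable instance : SMul K (LeavittPathAlgebra K E) where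
  smul k := Quotient.map' (k • ·) fun _ _ h => LeavittPath.congruence_smul K E k h

theorem mk_smul (k : K) (a : LeavittPath.FreeAlg K E) : mk K E (k • a) = k • mk K E a := rfl

noncomputable instance : Module K (LeavittPathAlgebra K E) :=
  Function.Surjective.module K
    ({ toFun := mk K E, map_zero' := mk_zero K E, map_add' := mk_add K E } :
      LeavittPath.FreeAlg K E →+ LeavittPathAlgebra K E)
    (mk_surjective K E) (mk_smul K E)

instance : IsScalarTower K (LeavittPathAlgebra K E) (LeavittPathAlgebra K E) where
  smul_assoc k x y := by
    obtain ⟨a, rfl⟩ := mk_surjective K E x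
    obtain ⟨b, rfl⟩ := mk_surjective K E y
    simp only [smul_eq_mul, ← mk_smul, ← mk_mul, smul_mul_assoc]

noncomputable instance : SMulCommClass K (LeavittPathAlgebra K E) (LeavittPathAlgebra K E) where
  smul_comm k x y := by
    obtain ⟨a, rfl⟩ := mk_surjective K E x
    obtain ⟨b, rfl⟩ := mk_surjective K E y
    simp only [smul_eq_mul, ← mk_smul, ← mk_mul, mul_smul_comm]

end LeavittPathAlgebra

/-- A Baer ring: the right annihilator of every subset `S` is `e R` for an idempotent `e`, and the
left annihilator of every subset is `R e` for an idempotent `e`. For a unital ring each of the two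
conditions implies the other. Taking `S = ∅` one gets a left and a right identity,
so that a ring with this property always has an identity element. -/
def IsBaerRing (R : Type*) [NonUnitalRing R] : Prop :=
  (∀ S : Set R, ∃ e : R, IsIdempotentElem e ∧
    {x : R | ∀ a ∈ S, a * x = 0} = {x : R | ∃ y : R, x = e * y}) ∧
  (∀ S : Set R, ∃ e : R, IsIdempotentElem e ∧
    {x : R | ∀ a ∈ S, x * a = 0} = {x : R | ∃ y : R, x = y * e})

/-!
For a no-exit graph the Leavitt path algebra is, up to isomorphism, a finite product of matrix rings
over `K` (one for each sink) and over `K[T;T⁻¹]` (one for each cycle). The proof uses this structure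
without constructing the matrices.

Call a vertex a base vertex if it is a sink or the chosen vertex of a cycle. Three facts about base
vertices are needed.

* The corner `v L v` at a base vertex is a principal ideal domain (`hasPrincipalCorner_of_isSink`,
  `hasPrincipalCorner_of_isCyclic`). The algebra is spanned by the products `p q*` of paths and
  ghost paths (`pathSpan_eq_top`). At a sink only scalars remain. A vertex on a cycle without exits
  emits a unique path of each length, so its corner is spanned by the powers `cⁱ`, `i ∈ ℤ`, of the
  cycle `c`. These are units of the corner, nonzero as soon as `v ≠ 0`, and they lie in distinct
  degrees of the `ℤ`-grading (`exists_grading`), so the corner is the ring of Laurent polynomials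
  in `c`. Base vertices that might vanish in `L` are left out, hence no faithful representation
  of `L` is required.
* `v L w = 0` for distinct base vertices `v` and `w`, as no vertex is reached from both
  (`base_mul_mul_base`).
* The base vertices generate `L` as an ideal: the relation `v = ∑ e e*` carries membership from the
  ranges of the edges emitted by `v` to `v`, and in a finite graph every vertex leads to base
  vertices (`vertex_mem_iSup_base`).

These facts imply the Baer property in any ring with identity (`IsBaerRing.of_principalCorners`).
Write the part of `1` in the ideal generated by `v` as `∑ aₖ bₖ` with `aₖ ∈ R v` and `bₖ ∈ v R`.
The vectors `f` over the corner with `s ∑ aₖ fₖ = 0` for all `s ∈ S` form a saturated submodule of a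
finite free module over a principal ideal domain, which is a direct summand, and the matrix of a
projection onto it gives the `v`-part of the idempotent that generates the right annihilator of `S`.
-/

/-! ### A criterion for Baer rings -/

section Baer

variable {R : Type*} [NonUnitalRing R]

/-- The idempotent `v` of `R` has a principal corner if `v R v` is (the isomorphic image under `φ`
of) a principal ideal domain `D`. The corner is described through `φ`, which need not preserve
identities: `R` may have none. -/
def HasPrincipalCorner (v : R) : Prop :=
  ∃ (D : Type w) (_ : CommRing D) (_ : IsDomain D) (_ : IsPrincipalIdealRing D) (φ : D →ₙ+* R),
    Function.Injective φ ∧ φ 1 = v ∧ ∀ x, ∃ d, φ d = v * x * v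

/-- A saturated submodule of a finite free module over a principal ideal domain is a direct
summand: the quotient is torsion-free, hence free. -/
theorem Submodule.exists_projection_of_saturated {D M : Type*} [CommRing D] [IsDomain D]
    [IsPrincipalIdealRing D] [AddCommGroup M] [Module D M] [Module.Finite D M]
    (N : Submodule D M) (hN : ∀ (r : D) (x : M), r ≠ 0 → r • x ∈ N → x ∈ N) :
    ∃ π : M →ₗ[D] M, (∀ x, π x ∈ N) ∧ ∀ x ∈ N, π x = x := by
  have : Module.IsTorsionFree D (M ⧸ N) := by
    rw [Module.isTorsionFree_iff_smul_eq_zero]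
    intro r x hx
    obtain ⟨y, rfl⟩ := N.mkQ_surjective x
    by_cases hr : r = 0
    · exact Or.inl hr
    · right
      rw [← map_smul, Submodule.mkQ_apply, Submodule.Quotient.mk_eq_zero] at hx
      rw [Submodule.mkQ_apply, Submodule.Quotient.mk_eq_zero]
      exact hN r y hr hx
  obtain ⟨σ, hσ⟩ := Module.projective_lifting_property N.mkQ LinearMap.id N.mkQ_surjective
  refine ⟨LinearMap.id - σ ∘ₗ N.mkQ, fun x => ?_, fun x hx => ?_⟩
  · rw [← Submodule.Quotient.mk_eq_zero, ← Submodule.mkQ_apply]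
    have := LinearMap.congr_fun hσ (N.mkQ x)
    rw [LinearMap.comp_apply, LinearMap.id_apply] at this
    rw [LinearMap.sub_apply, map_sub, LinearMap.id_apply, LinearMap.comp_apply, this, sub_self]
  · have : N.mkQ x = 0 := by simpa using hx
    rw [LinearMap.sub_apply, LinearMap.comp_apply, this, map_zero, sub_zero, LinearMap.id_apply]

/-- One block of a Baer decomposition. The element `h = ∑ aₖ bₖ` lies in the ideal `R φ(1) R` and
acts as an identity on `R φ(1)` and `φ(1) R`. The right annihilator of `S` in `R φ(1)` is the image
of a saturated submodule of `Dⁿ`, and the matrix of a projection onto that submodule yields `e`. -/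
theorem exists_rightAnnihilator_block {D : Type*} [CommRing D] [IsDomain D]
    [IsPrincipalIdealRing D] (φ : D →ₙ+* R) (hinj : Function.Injective φ)
    (hcorner : ∀ x, ∃ d, φ d = φ 1 * x * φ 1) {n : ℕ} (a b : Fin n → R)
    (ha : ∀ k, a k * φ 1 = a k) (hb : ∀ k, φ 1 * b k = b k) (h : R) (hab : ∑ k, a k * b k = h)
    (hl : ∀ x, x * φ 1 = x → h * x = x) (hr : ∀ y, φ 1 * y = y → y * h = y) (S : Set R) :
    ∃ e : R, (∀ s ∈ S, s * e = 0) ∧ ∀ x, (∀ s ∈ S, s * x = 0) → e * x = h * x := by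
  let Φ : (Fin n → D) → R := fun f => ∑ k, a k * φ (f k)
  have hΦ : ∀ f, Φ f * φ 1 = Φ f := fun f => by
    simp only [Φ, Finset.sum_mul, mul_assoc, ← map_mul, mul_one]
  have hΦ_smul : ∀ (r : D) f, Φ (r • f) = Φ f * φ r := fun r f => by
    simp only [Φ, Finset.sum_mul, mul_assoc, ← map_mul, Pi.smul_apply, smul_eq_mul, mul_comm r]
  have hΦ_add : ∀ f g, Φ (f + g) = Φ f + Φ g := fun f g => by
    simp only [Φ, Pi.add_apply, map_add, mul_add, Finset.sum_add_distrib]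
  have hΦ_zero : Φ 0 = 0 := by simp [Φ]
  have hΦ_sum : ∀ (F : Fin n → Fin n → D), Φ (∑ k, F k) = ∑ k, Φ (F k) := fun F =>
    map_sum (⟨⟨Φ, hΦ_zero⟩, hΦ_add⟩ : (Fin n → D) →+ R) F Finset.univ
  let N : Submodule D (Fin n → D) :=
    { carrier := {f | ∀ s ∈ S, s * Φ f = 0}
      zero_mem' := fun s _ => by rw [hΦ_zero, mul_zero]
      add_mem' := fun hf hg s hs => by rw [hΦ_add, mul_add, hf s hs, hg s hs, add_zero]
      smul_mem' := fun r f hf s hs => by rw [hΦ_smul, ← mul_assoc, hf s hs, zero_mul] }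
  -- `N` is saturated: the entries `b k * s * Φ f` lie in the domain `φ D` and determine `s * Φ f`.
  have hN : ∀ (r : D) (f : Fin n → D), r ≠ 0 → r • f ∈ N → f ∈ N := by
    intro r f hr0 hf s hs
    have h1 : s * Φ f * φ r = 0 := by rw [mul_assoc, ← hΦ_smul]; exact hf s hs
    have h2 : s * Φ f * φ 1 = s * Φ f := by rw [mul_assoc, hΦ]
    rw [← hl _ h2, ← hab, Finset.sum_mul]
    refine Finset.sum_eq_zero fun k _ => ?_
    obtain ⟨d, hd⟩ := hcorner (b k * (s * Φ f))
    have h3 : φ d = b k * (s * Φ f) := by rw [hd, ← mul_assoc, hb, mul_assoc, h2]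
    have h4 : φ (d * r) = 0 := by rw [map_mul, h3, mul_assoc, h1, mul_zero]
    have h5 : d = 0 := by
      rw [← map_zero φ] at h4
      exact (mul_eq_zero.1 (hinj h4)).resolve_right hr0
    rw [mul_assoc, ← h3, h5, map_zero, mul_zero]
  obtain ⟨π, hπN, hπ⟩ := N.exists_projection_of_saturated hN
  refine ⟨∑ k, Φ (π (Pi.single k 1)) * b k, fun s hs => ?_, fun x hx => ?_⟩
  · rw [Finset.mul_sum]
    refine Finset.sum_eq_zero fun k _ => ?_
    rw [← mul_assoc, hπN _ s hs, zero_mul]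
  · -- It suffices to compare the two sides after multiplying by each `a r` on the right.
    have key : ∀ r, (∑ k, Φ (π (Pi.single k 1)) * b k) * (x * a r) = h * (x * a r) := by
      intro r
      choose f hf using fun k => hcorner (b k * (x * a r))
      have hf' : ∀ k, φ (f k) = b k * (x * a r) := fun k => by
        rw [hf, ← mul_assoc, hb, mul_assoc, mul_assoc, ha]
      have h1 : Φ f = h * (x * a r) := by
        simp only [Φ, hf', ← mul_assoc, ← Finset.sum_mul, hab]
      have h2 : h * (x * a r) = x * a r := hl _ (by rw [mul_assoc, ha])
      have h3 : f ∈ N := fun s hs => by rw [h1, h2, ← mul_assoc, hx s hs, zero_mul]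
      have h4 : f = ∑ k, f k • (Pi.single k 1 : Fin n → D) := by
        ext j; simp [Finset.sum_apply, Pi.single_apply]
      calc _ = ∑ k, Φ (f k • π (Pi.single k 1)) := by
            simp only [hΦ_smul, hf', Finset.sum_mul, mul_assoc]
        _ = Φ (π f) := by
            conv_rhs => rw [h4]
            simp only [map_sum, map_smul, hΦ_sum]
        _ = _ := by rw [hπ f h3, h1]
    have hxh : ∀ c : R, c * (x * h) = ∑ r, c * (x * a r) * b r := fun c => by
      simp only [← hab, Finset.mul_sum, mul_assoc]
    have h6 : ∀ k, b k * x * h = b k * x := fun k => hr _ (by rw [← mul_assoc, hb])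
    have h7 := Finset.sum_congr rfl fun r (_ : r ∈ Finset.univ) => congrArg (· * b r) (key r)
    simp only [← hxh] at h7
    have h8 : h * (x * h) = h * x := by
      simp only [← hab, Finset.sum_mul (f := fun k => a k * b k), mul_assoc]
      rw [hab]
      simp only [← mul_assoc]
      simp only [mul_assoc (a _), h6]
    have h9 : (∑ k, Φ (π (Pi.single k 1)) * b k) * (x * h) =
        (∑ k, Φ (π (Pi.single k 1)) * b k) * x := by
      simp only [Finset.sum_mul, mul_assoc]
      simp only [← mul_assoc (b _), h6]
    rw [← h9, h7, h8]

/-- If every right annihilator of a ring with identity `o` is generated by an idempotent, so is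
every left annihilator: the left annihilator `T` of `S` is the left annihilator of the right
annihilator `e R` of `T`. -/
theorem IsBaerRing.of_rightAnnihilator (o : R) (ho : ∀ x, o * x = x) (ho' : ∀ x, x * o = x)
    (H : ∀ S : Set R, ∃ e : R, (∀ s ∈ S, s * e = 0) ∧ ∀ x, (∀ s ∈ S, s * x = 0) → e * x = x) :
    IsBaerRing R := by
  refine ⟨fun S => ?_, fun S => ?_⟩
  · obtain ⟨e, he, hx⟩ := H S
    refine ⟨e, hx e he, Set.ext fun x => ⟨fun h => ⟨x, (hx x h).symm⟩, ?_⟩⟩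
    rintro ⟨y, rfl⟩ s hs
    rw [← mul_assoc, he s hs, zero_mul]
  · obtain ⟨e, he, hx⟩ := H {x | ∀ a ∈ S, x * a = 0}
    have hee : e * e = e := hx e he
    refine ⟨o - e, ?_, Set.ext fun x => ⟨fun h => ⟨x, ?_⟩, ?_⟩⟩
    · rw [IsIdempotentElem, sub_mul, mul_sub, mul_sub, hee, ho, ho, ho', sub_self, sub_zero]
    · rw [mul_sub, he x h, ho', sub_zero]
    · rintro ⟨y, rfl⟩ a ha
      rw [mul_assoc, sub_mul, ho, hx a fun t ht => ht a ha, sub_self, mul_zero]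

/-- A ring with identity `o` is a Baer ring if `o` lies in the ideal generated by finitely many
idempotents `v i` that have principal corners and satisfy `v i R v j = 0` for `i ≠ j`. -/
theorem IsBaerRing.of_principalCorners {ι : Type*} [Finite ι] (v : ι → R)
    (hv : ∀ i, HasPrincipalCorner.{w} (v i)) (hvv : ∀ i j, i ≠ j → ∀ x, v i * x * v j = 0)
    (o : R) (ho : ∀ x, o * x = x) (ho' : ∀ x, x * o = x)
    (hspan : o ∈ ⨆ i, Submodule.span ℤ {x | ∃ a b : R, x = a * v i * b}) :
    IsBaerRing R := by
  classical
  have := Fintype.ofFinite ι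
  obtain ⟨g, hg, hgo⟩ : ∃ g : ι → R,
      (∀ i, g i ∈ Submodule.span ℤ {x | ∃ a b : R, x = a * v i * b}) ∧ ∑ i, g i = o := by
    have := (Submodule.mem_iSup_finset_iff_exists_sum (s := Finset.univ)
      (fun i => Submodule.span ℤ {x | ∃ a b : R, x = a * v i * b}) o).1 (by simpa using hspan)
    obtain ⟨μ, hμ⟩ := this
    exact ⟨fun i => μ i, fun i => (μ i).2, hμ⟩
  have hvi : ∀ i, v i * v i = v i := fun i => by
    obtain ⟨D, _, _, _, φ, -, h1, -⟩ := hv i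
    rw [← h1, ← map_mul, mul_one]
  have hrep : ∀ i, ∃ (n : ℕ) (a b : Fin n → R), (∀ k, a k * v i = a k) ∧ (∀ k, v i * b k = b k) ∧
      ∑ k, a k * b k = g i := by
    intro i
    obtain ⟨n, f, y, hy⟩ := Submodule.mem_span_set'.1 (hg i)
    choose a b hab using fun k => (y k).2
    refine ⟨n, fun k => (f k • a k) * v i, fun k => v i * b k, fun k => ?_, fun k => ?_, ?_⟩
    · rw [mul_assoc, hvi]
    · rw [← mul_assoc, hvi]
    · rw [← hy]
      refine Finset.sum_congr rfl fun k _ => ?_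
      change f k • a k * v i * (v i * b k) = _
      rw [hab, smul_mul_assoc, smul_mul_assoc, ← mul_assoc, mul_assoc (a k), hvi]
  have hgl : ∀ i j, i ≠ j → ∀ x, x * v i = x → g j * x = 0 := by
    intro i j hij x hx
    obtain ⟨n, a, b, ha, hb, hab⟩ := hrep j
    rw [← hab, Finset.sum_mul]
    refine Finset.sum_eq_zero fun k _ => ?_
    rw [← hb k, ← hx, mul_assoc, mul_assoc, ← mul_assoc (b k), ← mul_assoc (v j),
      hvv j i hij.symm, mul_zero]
  have hgr : ∀ i j, i ≠ j → ∀ x, v i * x = x → x * g j = 0 := by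
    intro i j hij x hx
    obtain ⟨n, a, b, ha, hb, hab⟩ := hrep j
    rw [← hab, Finset.mul_sum]
    refine Finset.sum_eq_zero fun k _ => ?_
    rw [← ha k, ← hx, ← mul_assoc, ← mul_assoc, mul_assoc (v i), hvv i j hij, zero_mul]
  refine IsBaerRing.of_rightAnnihilator o ho ho' fun S => ?_
  have hblock : ∀ i, ∃ e : R, (∀ s ∈ S, s * e = 0) ∧
      ∀ x, (∀ s ∈ S, s * x = 0) → e * x = g i * x := by
    intro i
    obtain ⟨n, a, b, ha, hb, hab⟩ := hrep i
    obtain ⟨D, _, _, _, φ, hφ, h1, hc⟩ := hv i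
    rw [← h1] at ha hb hc
    refine exists_rightAnnihilator_block φ hφ hc a b ha hb (g i) hab (fun x hx => ?_)
      (fun x hx => ?_) S
    · rw [h1] at hx
      conv_rhs => rw [← ho x, ← hgo, Finset.sum_mul]
      exact (Finset.sum_eq_single i (fun j _ hj => hgl i j hj.symm x hx) (by simp)).symm
    · rw [h1] at hx
      conv_rhs => rw [← ho' x, ← hgo, Finset.mul_sum]
      exact (Finset.sum_eq_single i (fun j _ hj => hgr i j hj.symm x hx) (by simp)).symm
  choose e he hex using hblock
  refine ⟨∑ i, e i, fun s hs => ?_, fun x hx => ?_⟩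
  · rw [Finset.mul_sum]
    exact Finset.sum_eq_zero fun i _ => he i s hs
  · rw [Finset.sum_mul]
    simp only [hex _ x hx]
    rw [← Finset.sum_mul, hgo, ho]

end Baer

/-! ### Generators and homomorphisms -/

namespace LeavittPathAlgebra

open LeavittPath

variable {K : Type w} [Field K] {E : DirectedMultigraph.{u, v}}

/-- A vertex as an element of the Leavitt path algebra. -/
noncomputable def vertex (x : E.Vertex) : LeavittPathAlgebra K E := mk K E (vert K E x)

/-- An edge as an element of the Leavitt path algebra. -/
noncomputable def edge (e : E.Edge) : LeavittPathAlgebra K E := mk K E (edg K E e)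

/-- The ghost edge `e*` as an element of the Leavitt path algebra. -/
noncomputable def ghost (e : E.Edge) : LeavittPathAlgebra K E := mk K E (gho K E e)

theorem mk_eq_of_rel {a b : FreeAlg K E} (h : Rel K E a b) : mk K E a = mk K E b :=
  (RingCon.eq _).2 (RingConGen.Rel.of _ _ h)

@[simp]
theorem vertex_mul_self (x : E.Vertex) : (vertex x * vertex x : LeavittPathAlgebra K E) = vertex x :=
  mk_eq_of_rel (.vertex_mul_self x)

theorem vertex_mul_of_ne {x y : E.Vertex} (h : x ≠ y) :
    (vertex x * vertex y : LeavittPathAlgebra K E) = 0 :=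
  mk_eq_of_rel (.vertex_mul_of_ne x y h)

@[simp]
theorem source_mul_edge (e : E.Edge) :
    (vertex (E.source e) * edge e : LeavittPathAlgebra K E) = edge e :=
  mk_eq_of_rel (.source_mul_edge e)

@[simp]
theorem edge_mul_range (e : E.Edge) :
    (edge e * vertex (E.range e) : LeavittPathAlgebra K E) = edge e :=
  mk_eq_of_rel (.edge_mul_range e)

@[simp]
theorem range_mul_ghost (e : E.Edge) :
    (vertex (E.range e) * ghost e : LeavittPathAlgebra K E) = ghost e :=
  mk_eq_of_rel (.range_mul_ghost e)

@[simp]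
theorem ghost_mul_source (e : E.Edge) :
    (ghost e * vertex (E.source e) : LeavittPathAlgebra K E) = ghost e :=
  mk_eq_of_rel (.ghost_mul_source e)

@[simp]
theorem ghost_mul_edge_self (e : E.Edge) :
    (ghost e * edge e : LeavittPathAlgebra K E) = vertex (E.range e) :=
  mk_eq_of_rel (.ghost_mul_self e)

theorem ghost_mul_edge_of_ne {e f : E.Edge} (h : e ≠ f) :
    (ghost e * edge f : LeavittPathAlgebra K E) = 0 :=
  mk_eq_of_rel (.ghost_mul_of_ne e f h)

theorem mk_sum {ι : Type*} (s : Finset ι) (f : ι → FreeAlg K E) :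
    mk K E (∑ i ∈ s, f i) = ∑ i ∈ s, mk K E (f i) :=
  map_sum (⟨⟨mk K E, rfl⟩, mk_add K E⟩ : FreeAlg K E →+ LeavittPathAlgebra K E) f s

theorem vertex_eq_sum (x : E.Vertex) (hfin : {e : E.Edge | E.source e = x}.Finite)
    (hne : {e : E.Edge | E.source e = x}.Nonempty) :
    (vertex x : LeavittPathAlgebra K E) = ∑ e ∈ hfin.toFinset, edge e * ghost e :=
  (mk_eq_of_rel (.vertex_eq_sum x hfin hne)).trans (mk_sum _ _)

/-- A `K`-submodule of `L_K(E)` closed under products that contains the generators is everything. -/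
theorem induction_gen {p : LeavittPathAlgebra K E → Prop}
    (vertex : ∀ x, p (vertex x)) (edge : ∀ e, p (edge e)) (ghost : ∀ e, p (ghost e))
    (mul : ∀ a b, p a → p b → p (a * b)) (zero : p 0) (add : ∀ a b, p a → p b → p (a + b))
    (smul : ∀ (k : K) a, p a → p (k • a)) (a : LeavittPathAlgebra K E) : p a := by
  obtain ⟨a, rfl⟩ := mk_surjective K E a
  have hgen : ∀ g, p (mk K E (gen K E g)) := by
    rintro (x | e | e)
    exacts [vertex x, edge e, ghost e]
  have hword : ∀ m : FreeSemigroup (Generator E), p (mk K E (MonoidAlgebra.single m 1)) := by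
    intro m
    induction m using FreeSemigroup.recOnMul with
    | ih1 g => exact hgen g
    | ih2 g m h1 h2 =>
      have : (MonoidAlgebra.single (FreeSemigroup.of g * m) 1 : FreeAlg K E) =
          gen K E g * MonoidAlgebra.single m 1 := by
        rw [gen, MonoidAlgebra.single_mul_single, mul_one]
      rw [this, mk_mul]
      exact mul _ _ (hgen g) h2
  induction a using MonoidAlgebra.induction_linear with
  | zero => exact zero
  | add f g hf hg => exact add _ _ hf hg
  | single m k =>
    have : (MonoidAlgebra.single m k : FreeAlg K E) = k • MonoidAlgebra.single m 1 := by
      rw [MonoidAlgebra.smul_single, smul_eq_mul, mul_one]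
    rw [this, mk_smul]
    exact smul _ _ (hword m)

section Lift

variable {A : Type*} [NonUnitalRing A] [Module K A] [IsScalarTower K A A] [SMulCommClass K A A]

/-- The homomorphism from the free algebra given by its values on the generators. -/
noncomputable def freeLift (f : Generator E → A) : FreeAlg K E →ₙₐ[K] A :=
  MonoidAlgebra.liftMagma K (FreeSemigroup.lift f)

theorem freeLift_gen (f : Generator E → A) (g : Generator E) :
    freeLift f (gen K E g) = f g := by
  simp [freeLift, gen]

/-- Values on the generators that satisfy the defining relations extend to a homomorphism of
`K`-algebras on `L_K(E)`. -/
theorem exists_lift (f : Generator E → A)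
    (hf : ∀ a b, Rel K E a b → freeLift f a = freeLift f b) :
    ∃ F : LeavittPathAlgebra K E →ₙₐ[K] A, (∀ x, F (vertex x) = f (.vertex x)) ∧
      (∀ e, F (edge e) = f (.edge e)) ∧ ∀ e, F (ghost e) = f (.ghost e) := by
  have hF : ∀ a b, congruence K E a b → freeLift f a = freeLift f b := by
    intro a b h
    change RingConGen.Rel (Rel K E) _ _ at h
    induction h with
    | of _ _ h => exact hf _ _ h
    | refl _ => rfl
    | symm _ ih => exact ih.symm
    | trans _ _ ih₁ ih₂ => exact ih₁.trans ih₂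
    | add _ _ ih₁ ih₂ => rw [map_add, map_add, ih₁, ih₂]
    | mul _ _ ih₁ ih₂ => rw [map_mul, map_mul, ih₁, ih₂]
  let F : LeavittPathAlgebra K E → A := fun x => Quotient.liftOn' x (freeLift f) hF
  have hFmk : ∀ a, F (mk K E a) = freeLift f a := fun _ => rfl
  refine ⟨{ toFun := F, map_smul' := ?_, map_zero' := ?_, map_add' := ?_, map_mul' := ?_ },
    fun x => freeLift_gen f _, fun e => freeLift_gen f _, fun e => freeLift_gen f _⟩
  · intro k x
    obtain ⟨a, rfl⟩ := mk_surjective K E x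
    rw [← mk_smul, hFmk, hFmk, map_smul]; rfl
  · rw [← mk_zero, hFmk, map_zero]
  · intro x y
    obtain ⟨a, rfl⟩ := mk_surjective K E x
    obtain ⟨b, rfl⟩ := mk_surjective K E y
    rw [← mk_add, hFmk, hFmk, hFmk, map_add]
  · intro x y
    obtain ⟨a, rfl⟩ := mk_surjective K E x
    obtain ⟨b, rfl⟩ := mk_surjective K E y
    rw [← mk_mul, hFmk, hFmk, hFmk, map_mul]

end Lift

open TensorProduct LaurentPolynomial in
/-- The `ℤ`-grading of `L_K(E)` with edges in degree `1` and ghost edges in degree `-1`, written as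
a coaction of the Laurent polynomials. -/
theorem exists_grading : ∃ F : LeavittPathAlgebra K E →ₙₐ[K] K[T;T⁻¹] ⊗[K] LeavittPathAlgebra K E,
    (∀ x, F (vertex x) = T 0 ⊗ₜ vertex x) ∧ (∀ e, F (edge e) = T 1 ⊗ₜ edge e) ∧
      ∀ e, F (ghost e) = T (-1) ⊗ₜ ghost e := by
  let f : Generator E → K[T;T⁻¹] ⊗[K] LeavittPathAlgebra K E := fun g =>
    match g with
    | .vertex x => T 0 ⊗ₜ vertex x
    | .edge e => T 1 ⊗ₜ edge e
    | .ghost e => T (-1) ⊗ₜ ghost e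
  have hv : ∀ x, freeLift f (vert K E x) = T 0 ⊗ₜ vertex x := fun x => freeLift_gen f _
  have he : ∀ e, freeLift f (edg K E e) = T 1 ⊗ₜ edge e := fun e => freeLift_gen f _
  have hg : ∀ e, freeLift f (gho K E e) = T (-1) ⊗ₜ ghost e := fun e => freeLift_gen f _
  refine exists_lift f fun a b h => ?_
  induction h with
  | smul k h ih => rw [map_smul, map_smul, ih]
  | vertex_mul_self x =>
    simp only [map_mul, hv, Algebra.TensorProduct.tmul_mul_tmul, ← T_add,
      vertex_mul_self, add_zero]
  | vertex_mul_of_ne x y h =>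
    simp only [map_mul, hv, Algebra.TensorProduct.tmul_mul_tmul, ← T_add,
      vertex_mul_of_ne h, tmul_zero, map_zero]
  | source_mul_edge e =>
    simp only [map_mul, hv, he, Algebra.TensorProduct.tmul_mul_tmul, ← T_add,
      source_mul_edge, zero_add]
  | edge_mul_range e =>
    simp only [map_mul, hv, he, Algebra.TensorProduct.tmul_mul_tmul, ← T_add,
      edge_mul_range, add_zero]
  | range_mul_ghost e =>
    simp only [map_mul, hv, hg, Algebra.TensorProduct.tmul_mul_tmul, ← T_add,
      range_mul_ghost, zero_add]
  | ghost_mul_source e =>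
    simp only [map_mul, hv, hg, Algebra.TensorProduct.tmul_mul_tmul, ← T_add,
      ghost_mul_source, add_zero]
  | ghost_mul_self e =>
    simp only [map_mul, hv, he, hg, Algebra.TensorProduct.tmul_mul_tmul, ← T_add,
      ghost_mul_edge_self, neg_add_cancel]
  | ghost_mul_of_ne e f h =>
    simp only [map_mul, he, hg, Algebra.TensorProduct.tmul_mul_tmul, ← T_add,
      ghost_mul_edge_of_ne h, tmul_zero, map_zero]
  | vertex_eq_sum x hfin hne =>
    simp only [map_sum, map_mul, hv, he, hg,
      Algebra.TensorProduct.tmul_mul_tmul, ← T_add, add_neg_cancel]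
    rw [vertex_eq_sum x hfin hne, tmul_sum]

end LeavittPathAlgebra

/-! ### Vertices on cycles of a no-exit graph -/

namespace DirectedMultigraph

open Relation

variable (E : DirectedMultigraph.{u, v})

/-- There is an edge from `x` to `y`. -/
def Adj (x y : E.Vertex) : Prop := ∃ e, E.source e = x ∧ E.range e = y

/-- There is a path of length at least `0` from `x` to `y`. -/
def Reach : E.Vertex → E.Vertex → Prop := ReflTransGen E.Adj

/-- The vertex `x` emits no edge. -/
def IsSink (x : E.Vertex) : Prop := ∀ e, E.source e ≠ x

/-- There is a path of positive length from `x` to `x`. -/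
def IsCyclic (x : E.Vertex) : Prop := TransGen E.Adj x x

/-- The edges of `p`, possibly none, form a path from `x` to `z`. -/
def Joins : E.Vertex → List E.Edge → E.Vertex → Prop
  | x, [], z => x = z
  | x, e :: p, z => E.source e = x ∧ Joins (E.range e) p z

variable {E}

theorem Joins.exists_suffix {x y z : E.Vertex} {p : List E.Edge} (h : E.Joins x p z)
    (hy : y ∈ p.map E.source) : ∃ q, q <:+ p ∧ E.Joins y q z := by
  induction p generalizing x with
  | nil => simp at hy
  | cons e p ih =>
    rcases List.mem_cons.1 hy with rfl | hy
    · exact ⟨e :: p, List.suffix_refl _, rfl, h.2⟩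
    · obtain ⟨q, hq, hj⟩ := ih h.2 hy
      exact ⟨q, hq.trans (List.suffix_cons e p), hj⟩

/-- A path can be shortened to one whose edges have distinct sources, none of them the endpoint. -/
theorem Reach.exists_simple_path {x z : E.Vertex} (h : E.Reach x z) :
    ∃ p, E.Joins x p z ∧ (p.map E.source).Nodup ∧ z ∉ p.map E.source := by
  induction h using ReflTransGen.head_induction_on with
  | refl => exact ⟨[], rfl, by simp, by simp⟩
  | @head a c hac _ ih =>
    obtain ⟨p, hp, hnd, hz⟩ := ih
    obtain ⟨e, rfl, rfl⟩ := hac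
    by_cases haz : E.source e = z
    · exact ⟨[], haz, by simp, by simp⟩
    by_cases hmem : E.source e ∈ p.map E.source
    · obtain ⟨q, hq, hj⟩ := hp.exists_suffix hmem
      have hsub := hq.sublist.map E.source
      exact ⟨q, hj, hnd.sublist hsub, fun h => hz (hsub.subset h)⟩
    · refine ⟨e :: p, ⟨rfl, hp⟩, ?_, ?_⟩
      · rw [List.map_cons, List.nodup_cons]
        exact ⟨hmem, hnd⟩
      · rw [List.map_cons, List.mem_cons, not_or]
        exact ⟨fun h => haz h.symm, hz⟩

theorem Joins.isPath {e : E.Edge} {p : List E.Edge} {z : E.Vertex}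
    (h : E.Joins (E.range e) p z) :
    (e :: p).IsChain (fun e f => E.range e = E.source f) ∧
      ∀ hp : e :: p ≠ [], E.range ((e :: p).getLast hp) = z := by
  induction p generalizing e with
  | nil => exact ⟨by simp, fun _ => h⟩
  | cons f p ih =>
    obtain ⟨h1, h2⟩ := ih h.2
    refine ⟨List.isChain_cons_cons.2 ⟨h.1.symm, h1⟩, fun hp => ?_⟩
    rw [List.getLast_cons (by simp)]
    exact h2 _

/-- In a no-exit graph, an edge along which one can return to its source is the only edge emitted
by that source. -/
theorem IsNoExit.edge_unique (hE : E.IsNoExit) {e f : E.Edge}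
    (h : E.Reach (E.range e) (E.source e)) (hf : E.source f = E.source e) : f = e := by
  by_contra hne
  obtain ⟨p, hp, hnd, hz⟩ := h.exists_simple_path
  obtain ⟨h1, h2⟩ := hp.isPath
  refine hE (e :: p) ⟨⟨⟨by simp, h1⟩, fun hp => ?_⟩, ?_⟩ f ⟨e, by simp, hf, hne⟩
  · rw [h2 hp, List.head_cons]
  · rw [List.map_cons, List.nodup_cons]
    exact ⟨hz, hnd⟩

/-- A cyclic vertex of a no-exit graph emits exactly one edge, and the range of that edge
is cyclic. -/
theorem IsNoExit.exists_next (hE : E.IsNoExit) {x : E.Vertex} (hx : E.IsCyclic x) :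
    ∃ e, E.source e = x ∧ (∀ f, E.source f = x → f = e) ∧ E.IsCyclic (E.range e) ∧
      E.Reach (E.range e) x := by
  obtain ⟨c, ⟨e, rfl, rfl⟩, hc⟩ := TransGen.head'_iff.1 hx
  exact ⟨e, rfl, fun f hf => hE.edge_unique hc hf, TransGen.tail' hc ⟨e, rfl, rfl⟩, hc⟩

/-- In a no-exit graph, everything that a cyclic vertex reaches is on the same cycle. -/
theorem IsNoExit.cyclic_of_reach (hE : E.IsNoExit) {x z : E.Vertex} (hx : E.IsCyclic x)
    (h : E.Reach x z) : E.IsCyclic z ∧ E.Reach z x := by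
  induction h using ReflTransGen.head_induction_on with
  | refl => exact ⟨hx, .refl⟩
  | @head a c hac _ ih =>
    obtain ⟨e, rfl, hu, hc, hr⟩ := hE.exists_next hx
    obtain ⟨f, hf, rfl⟩ := hac
    obtain rfl := hu f hf
    exact ⟨(ih hc).1, (ih hc).2.trans hr⟩

theorem IsSink.eq_of_reach {x z : E.Vertex} (hx : E.IsSink x) (h : E.Reach x z) : x = z := by
  rcases ReflTransGen.cases_head h with h | ⟨c, ⟨e, he, -⟩, -⟩
  exacts [h, (hx e he).elim]

variable (E) in
/-- Two vertices are equivalent if each reaches the other. -/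
def reachSetoid : Setoid E.Vertex where
  r x y := E.Reach x y ∧ E.Reach y x
  iseqv := ⟨fun _ => ⟨.refl, .refl⟩, fun h => ⟨h.2, h.1⟩,
    fun h h' => ⟨h.1.trans h'.1, h'.2.trans h.2⟩⟩

/-- A choice of one vertex in each class of vertices that reach each other. -/
noncomputable def rep (x : E.Vertex) : E.Vertex :=
  Quotient.out (s := E.reachSetoid) (Quotient.mk E.reachSetoid x)

theorem reach_rep (x : E.Vertex) : E.Reach x (rep x) ∧ E.Reach (rep x) x :=
  And.symm (Quotient.mk_out (s := E.reachSetoid) x)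

theorem rep_eq {x y : E.Vertex} (h : E.Reach x y) (h' : E.Reach y x) : rep x = rep y :=
  congrArg (Quotient.out (s := E.reachSetoid)) (Quotient.sound (s := E.reachSetoid) ⟨h, h'⟩)

/-- A base vertex: a sink, or the chosen vertex of a cycle. The condition `rep x = x` excludes no
sink, since a sink reaches only itself. -/
def IsBase (x : E.Vertex) : Prop := (E.IsSink x ∨ E.IsCyclic x) ∧ rep x = x

theorem IsNoExit.base_eq (hE : E.IsNoExit) {x y z : E.Vertex} (hx : IsBase x) (hy : IsBase y)
    (hxz : E.Reach x z) (hyz : E.Reach y z) : x = y := by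
  have key : ∀ {x : E.Vertex}, IsBase x → E.Reach x z → E.Reach z x := by
    rintro x ⟨hx | hx, -⟩ h
    · rw [hx.eq_of_reach h]; exact .refl
    · exact (hE.cyclic_of_reach hx h).2
  rw [← hx.2, ← hy.2]
  exact rep_eq (hxz.trans (key hy hyz)) (hyz.trans (key hx hxz))

/-- A property of vertices holds everywhere as soon as it holds at the base vertices and passes from
the ranges of the edges emitted by a vertex to that vertex. -/
theorem IsNoExit.induction_on_base [Finite E.Vertex] (hE : E.IsNoExit) {p : E.Vertex → Prop}
    (hbase : ∀ x, IsBase x → p x)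
    (hstep : ∀ x, ¬ E.IsSink x → (∀ e, E.source e = x → p (E.range e)) → p x) (x : E.Vertex) :
    p x := by
  have hcyc : ∀ x, E.IsCyclic x → p x := by
    intro x hx
    -- The property travels back along a path to the chosen vertex of the cycle, because each vertex
    -- on that path emits a single edge.
    have h := (reach_rep x).1
    have hr : IsBase (rep x) :=
      ⟨.inr (hE.cyclic_of_reach hx h).1, rep_eq (reach_rep x).2 (reach_rep x).1⟩
    generalize rep x = y at h hr
    induction h using ReflTransGen.head_induction_on with
    | refl => exact hbase _ hr
    | @head a c hac _ ih =>
      obtain ⟨e, rfl, hu, hc, -⟩ := hE.exists_next hx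
      obtain ⟨f, hf, rfl⟩ := hac
      obtain rfl := hu f hf
      refine hstep _ (fun h => h f rfl) fun g hg => ?_
      rw [hu g hg]
      exact ih hc
  -- Strict reachability is well-founded because there are finitely many vertices, and all edges out
  -- of a non-cyclic vertex strictly descend.
  let r : E.Vertex → E.Vertex → Prop := fun y x => E.Reach x y ∧ ¬ E.Reach y x
  have : IsTrans E.Vertex r :=
    ⟨fun a b c h h' => ⟨h'.1.trans h.1, fun h'' => h'.2 (h.1.trans h'')⟩⟩
  have : Std.Irrefl r := ⟨fun a h => h.2 h.1⟩
  induction x using (Finite.wellFounded_of_trans_of_irrefl r).induction with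
  | _ x ih =>
    by_cases hs : E.IsSink x
    · exact hbase x ⟨.inl hs, (hs.eq_of_reach (reach_rep x).1).symm⟩
    by_cases hx : E.IsCyclic x
    · exact hcyc x hx
    · refine hstep x hs fun e he => ih _ ⟨.single ⟨e, he, rfl⟩, fun h => hx ?_⟩
      exact TransGen.head' ⟨e, he, rfl⟩ h

end DirectedMultigraph

/-! ### The spanning set of products of paths and ghost paths -/

namespace LeavittPathAlgebra

variable {K : Type w} [Field K] {E : DirectedMultigraph.{u, v}}

/-- `IsPathPair x z p q`: for some path from `x` to `z`, of length at least `0`, the element `p`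
is the product of its edges and `q` is the product of its ghost edges in the reverse order. -/
inductive IsPathPair : E.Vertex → E.Vertex → LeavittPathAlgebra K E → LeavittPathAlgebra K E → Prop
  | nil (x : E.Vertex) : IsPathPair x x (vertex x) (vertex x)
  | cons (e : E.Edge) {z : E.Vertex} {p q : LeavittPathAlgebra K E}
      (h : IsPathPair (E.range e) z p q) : IsPathPair (E.source e) z (edge e * p) (q * ghost e)

namespace IsPathPair

variable {x z : E.Vertex} {p q : LeavittPathAlgebra K E}

theorem reach (h : IsPathPair x z p q) : E.Reach x z := by
  induction h with
  | nil => exact .refl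
  | cons e _ ih => exact .head ⟨e, rfl, rfl⟩ ih

theorem vertex_mul_path (h : IsPathPair x z p q) : vertex x * p = p := by
  cases h with
  | nil => simp
  | cons e h => rw [← mul_assoc, source_mul_edge]

theorem ghost_mul_vertex (h : IsPathPair x z p q) : q * vertex x = q := by
  cases h with
  | nil => simp
  | cons e h => rw [mul_assoc, ghost_mul_source]

theorem snoc (h : IsPathPair x z p q) (e : E.Edge) (he : E.source e = z) :
    IsPathPair x (E.range e) (p * edge e) (ghost e * q) := by
  induction h with
  | nil =>
    subst he
    have := IsPathPair.cons (K := K) e (.nil _)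
    simpa using this
  | cons f h ih =>
    have := (ih he).cons f
    rwa [← mul_assoc, mul_assoc (ghost e)] at this

theorem vertex_mul_ghost (h : IsPathPair x z p q) : vertex z * q = q := by
  induction h with
  | nil => simp
  | cons e _ ih => rw [← mul_assoc, ih]

theorem ghost_mul_path (h : IsPathPair x z p q) : q * p = vertex z := by
  induction h with
  | nil => exact vertex_mul_self _
  | cons e h ih =>
    rw [mul_assoc, ← mul_assoc (ghost e), ghost_mul_edge_self, h.vertex_mul_path, ih]

end IsPathPair

variable (K E) in
/-- The span of the elements `p q*` for paths `p` and `q` with the same range. -/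
noncomputable def pathSpan : Submodule K (LeavittPathAlgebra K E) :=
  Submodule.span K {a | ∃ x y z p p' q q', IsPathPair x z p p' ∧ IsPathPair y z q q' ∧ a = p * q'}

/-- The span of the products `p q*` is a left ideal. In `e* p q*` the ghost edge cancels against the
first edge of `p`, or extends the path of `q` when `p` has length `0`. -/
theorem mul_mem_pathSpan (a : LeavittPathAlgebra K E) :
    ∀ b ∈ pathSpan K E, a * b ∈ pathSpan K E := by
  have key : ∀ a : LeavittPathAlgebra K E,
      (∀ x y z p p' q q', IsPathPair x z p p' → IsPathPair y z q q' → a * (p * q') ∈ pathSpan K E) →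
      ∀ b ∈ pathSpan K E, a * b ∈ pathSpan K E := by
    intro a ha b hb
    induction hb using Submodule.span_induction with
    | mem b hb =>
      obtain ⟨x, y, z, p, p', q, q', hp, hq, rfl⟩ := hb
      exact ha x y z p p' q q' hp hq
    | zero => rw [mul_zero]; exact zero_mem _
    | add b c _ _ hb hc => rw [mul_add]; exact add_mem hb hc
    | smul k b _ hb => rw [mul_smul_comm]; exact Submodule.smul_mem _ _ hb
  induction a using induction_gen with
  | vertex v =>
    refine key _ fun x y z p p' q q' hp hq => ?_
    by_cases h : v = x
    · subst h
      rw [← mul_assoc, hp.vertex_mul_path]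
      exact Submodule.subset_span ⟨_, _, _, _, _, _, _, hp, hq, rfl⟩
    · rw [← hp.vertex_mul_path, ← mul_assoc, ← mul_assoc, vertex_mul_of_ne h, zero_mul, zero_mul]
      exact zero_mem _
  | edge e =>
    refine key _ fun x y z p p' q q' hp hq => ?_
    by_cases h : E.range e = x
    · subst h
      rw [← mul_assoc]
      exact Submodule.subset_span ⟨_, _, _, _, _, _, _, hp.cons e, hq, rfl⟩
    · rw [← hp.vertex_mul_path, ← edge_mul_range e, mul_assoc, mul_assoc, ← mul_assoc (vertex _),
        vertex_mul_of_ne h, zero_mul, mul_zero]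
      exact zero_mem _
  | ghost e =>
    refine key _ fun x y z p p' q q' hp hq => ?_
    cases hp with
    | nil =>
      rw [hq.vertex_mul_ghost]
      by_cases h : E.source e = x
      · have := hq.snoc e h
        rw [← this.vertex_mul_ghost]
        exact Submodule.subset_span ⟨_, _, _, _, _, _, _, .nil _, this, rfl⟩
      · rw [← hq.vertex_mul_ghost, ← ghost_mul_source e, mul_assoc, ← mul_assoc (vertex _),
          vertex_mul_of_ne h, zero_mul, mul_zero]
        exact zero_mem _
    | cons f hp =>
      by_cases h : e = f
      · subst h
        rw [← mul_assoc, ← mul_assoc, ghost_mul_edge_self, hp.vertex_mul_path]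
        exact Submodule.subset_span ⟨_, _, _, _, _, _, _, hp, hq, rfl⟩
      · rw [← mul_assoc, ← mul_assoc, ghost_mul_edge_of_ne h, zero_mul, zero_mul]
        exact zero_mem _
  | mul a b ha hb => intro c hc; rw [mul_assoc]; exact ha _ (hb c hc)
  | zero => intro c _; rw [zero_mul]; exact zero_mem _
  | add a b ha hb => intro c hc; rw [add_mul]; exact add_mem (ha c hc) (hb c hc)
  | smul k a ha => intro c hc; rw [smul_mul_assoc]; exact Submodule.smul_mem _ _ (ha c hc)

theorem sum_vertex_mul [Fintype E.Vertex] (a : LeavittPathAlgebra K E) :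
    (∑ x, vertex x) * a = a := by
  classical
  have key : ∀ (x : E.Vertex) (a : LeavittPathAlgebra K E), vertex x * a = a →
      (∑ x, vertex x) * a = a := by
    intro x a h
    rw [← h, ← mul_assoc, Finset.sum_mul, Finset.sum_eq_single x, vertex_mul_self]
    · exact fun y _ hy => vertex_mul_of_ne hy
    · simp
  induction a using induction_gen with
  | vertex x => exact key x _ (vertex_mul_self x)
  | edge e => exact key _ _ (source_mul_edge e)
  | ghost e => exact key _ _ (range_mul_ghost e)
  | mul a b ha _ => rw [← mul_assoc, ha]
  | zero => rw [mul_zero]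
  | add a b ha hb => rw [mul_add, ha, hb]
  | smul k a ha => rw [mul_smul_comm, ha]

theorem mul_sum_vertex [Fintype E.Vertex] (a : LeavittPathAlgebra K E) :
    a * (∑ x, vertex x) = a := by
  classical
  have key : ∀ (x : E.Vertex) (a : LeavittPathAlgebra K E), a * vertex x = a →
      a * (∑ x, vertex x) = a := by
    intro x a h
    rw [← h, mul_assoc, Finset.mul_sum, Finset.sum_eq_single x, vertex_mul_self]
    · exact fun y _ hy => vertex_mul_of_ne hy.symm
    · simp
  induction a using induction_gen with
  | vertex x => exact key x _ (vertex_mul_self x)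
  | edge e => exact key _ _ (edge_mul_range e)
  | ghost e => exact key _ _ (ghost_mul_source e)
  | mul a b _ hb => rw [mul_assoc, hb]
  | zero => rw [zero_mul]
  | add a b ha hb => rw [add_mul, ha, hb]
  | smul k a ha => rw [smul_mul_assoc, ha]

theorem pathSpan_eq_top [Finite E.Vertex] : pathSpan K E = ⊤ := by
  have := Fintype.ofFinite E.Vertex
  refine eq_top_iff.2 fun a _ => ?_
  rw [← mul_sum_vertex a]
  refine mul_mem_pathSpan a _ (sum_mem fun x _ => ?_)
  rw [← vertex_mul_self]
  exact Submodule.subset_span ⟨_, _, _, _, _, _, _, .nil x, .nil x, rfl⟩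

/-- To control `vertex x * a * vertex y` it suffices to consider `a = p q*` for a path `p` starting
at `x` and a path `q` starting at `y`. -/
theorem vertex_mul_mul_vertex_mem [Finite E.Vertex] (x y : E.Vertex)
    (N : Submodule K (LeavittPathAlgebra K E))
    (h : ∀ z p p' q q', IsPathPair x z p p' → IsPathPair y z q q' → p * q' ∈ N)
    (a : LeavittPathAlgebra K E) : vertex x * a * vertex y ∈ N := by
  have ha : a ∈ pathSpan K E := by rw [pathSpan_eq_top]; trivial
  induction ha using Submodule.span_induction with
  | mem a ha =>
    obtain ⟨x', y', z, p, p', q, q', hp, hq, rfl⟩ := ha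
    by_cases hx : x = x'
    · by_cases hy : y' = y
      · subst hx hy
        rw [← mul_assoc, hp.vertex_mul_path, mul_assoc, hq.ghost_mul_vertex]
        exact h z p p' q q' hp hq
      · rw [← hq.ghost_mul_vertex, mul_assoc, mul_assoc, mul_assoc, vertex_mul_of_ne hy]
        simp
    · rw [← hp.vertex_mul_path, ← mul_assoc, ← mul_assoc, vertex_mul_of_ne hx]
      simp
  | zero => simp
  | add a b _ _ ha hb => rw [mul_add, add_mul]; exact add_mem ha hb
  | smul k a _ ha => rw [mul_smul_comm, smul_mul_assoc]; exact Submodule.smul_mem _ _ ha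

end LeavittPathAlgebra

/-! ### The corners at sinks and at cyclic vertices -/

/-- The Laurent polynomials over a field form a localization of the principal ideal domain of
polynomials, so their ideals are principal too. -/
theorem LaurentPolynomial.isPrincipalIdealRing (K : Type*) [Field K] :
    IsPrincipalIdealRing (LaurentPolynomial K) where
  principal I := by
    have := LaurentPolynomial.isLocalization (R := K)
    obtain ⟨f, hf⟩ := IsPrincipalIdealRing.principal
      (I.under (Polynomial K))
    refine ⟨algebraMap (Polynomial K) (LaurentPolynomial K) f, ?_⟩
    rw [← IsLocalization.map_under (Submonoid.powers (Polynomial.X : Polynomial K))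
      (LaurentPolynomial K) I, hf]
    simp only [Ideal.submodule_span_eq, Ideal.map_span, Set.image_singleton]

/-- Mutually inverse elements `c` and `d` of the corner at an idempotent `v` define a homomorphism
from the infinite cyclic group that sends the identity to `v`. -/
theorem exists_zpowers_mulHom {A : Type*} [NonUnitalRing A] {v c d : A} (hv : v * v = v)
    (hvc : v * c = c) (hcv : c * v = c) (hvd : v * d = d) (hdv : d * v = d)
    (hcd : c * d = v) (hdc : d * c = v) :
    ∃ ψ : Multiplicative ℤ →ₙ* A, ψ (.ofAdd 0) = v ∧ ψ (.ofAdd 1) = c ∧ ψ (.ofAdd (-1)) = d := by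
  have hI : IsIdempotentElem v := hv
  let u : hI.Cornerˣ :=
    ⟨⟨c, (Subsemigroup.mem_corner_iff hI).2 ⟨hvc, hcv⟩⟩,
      ⟨d, (Subsemigroup.mem_corner_iff hI).2 ⟨hvd, hdv⟩⟩, Subtype.ext hcd, Subtype.ext hdc⟩
  refine ⟨{ toFun := fun z => ((u ^ z.toAdd : hI.Cornerˣ) : hI.Corner).1, map_mul' := ?_ }, ?_⟩
  · intro a b
    rw [toAdd_mul, zpow_add, Units.val_mul]
    rfl
  · refine ⟨?_, ?_, ?_⟩
    · change ((u ^ (0 : ℤ) : hI.Cornerˣ) : hI.Corner).1 = v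
      rw [zpow_zero]; rfl
    · change ((u ^ (1 : ℤ) : hI.Cornerˣ) : hI.Corner).1 = c
      rw [zpow_one]
    · change ((u ^ (-1 : ℤ) : hI.Cornerˣ) : hI.Corner).1 = d
      rw [zpow_neg_one]; rfl

namespace LeavittPathAlgebra

open DirectedMultigraph

variable {K : Type w} [Field K] {E : DirectedMultigraph.{u, v}}

theorem IsPathPair.eq_of_isSink {x z : E.Vertex} {p q : LeavittPathAlgebra K E}
    (h : IsPathPair x z p q) (hx : E.IsSink x) : p = vertex x ∧ q = vertex x := by
  cases h with
  | nil => exact ⟨rfl, rfl⟩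
  | cons e h => exact (hx e rfl).elim

/-- The corner at a sink is `K`. -/
theorem hasPrincipalCorner_of_isSink [Finite E.Vertex] {x : E.Vertex} (hx : E.IsSink x)
    (h0 : (vertex x : LeavittPathAlgebra K E) ≠ 0) :
    HasPrincipalCorner.{w} (vertex x : LeavittPathAlgebra K E) := by
  refine ⟨K, inferInstance, inferInstance, inferInstance,
    { toFun := fun k => k • vertex x, map_zero' := zero_smul _ _,
      map_add' := fun k l => add_smul _ _ _,
      map_mul' := fun k l => by
        rw [smul_mul_assoc, mul_smul_comm, smul_smul, vertex_mul_self] },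
    smul_left_injective K h0, one_smul _ _, fun a => ?_⟩
  have := vertex_mul_mul_vertex_mem x x (Submodule.span K {(vertex x : LeavittPathAlgebra K E)})
    (fun z p p' q q' hp hq => by
      rw [(hp.eq_of_isSink hx).1, (hq.eq_of_isSink hx).2, vertex_mul_self]
      exact Submodule.mem_span_singleton_self _) a
  exact Submodule.mem_span_singleton.1 this

section Cycle

variable (hE : E.IsNoExit)

/-- The unique edge emitted by a cyclic vertex of a no-exit graph. -/
noncomputable def nextEdge (x : {x // E.IsCyclic x}) : E.Edge := (hE.exists_next x.2).choose

theorem source_nextEdge (x : {x // E.IsCyclic x}) : E.source (nextEdge hE x) = x :=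
  (hE.exists_next x.2).choose_spec.1

theorem eq_nextEdge {x : {x // E.IsCyclic x}} {e : E.Edge} (he : E.source e = x) :
    e = nextEdge hE x :=
  (hE.exists_next x.2).choose_spec.2.1 e he

/-- The vertex following a cyclic vertex on its cycle. -/
noncomputable def next (x : {x // E.IsCyclic x}) : {x // E.IsCyclic x} :=
  ⟨E.range (nextEdge hE x), (hE.exists_next x.2).choose_spec.2.2.1⟩

theorem exists_iterate_next (x : {x // E.IsCyclic x}) {z : E.Vertex} (h : E.Reach x z) :
    ∃ k, ((next hE)^[k] x : E.Vertex) = z := by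
  induction h with
  | refl => exact ⟨0, rfl⟩
  | @tail b c _ hbc ih =>
    obtain ⟨k, hk⟩ := ih
    obtain ⟨f, hf, rfl⟩ := hbc
    refine ⟨k + 1, ?_⟩
    rw [Function.iterate_succ_apply', eq_nextEdge hE (hf.trans hk.symm)]
    rfl

theorem mem_periodicPts_next (x : {x // E.IsCyclic x}) : x ∈ Function.periodicPts (next hE) := by
  obtain ⟨k, hk⟩ := exists_iterate_next hE (next hE x) (hE.exists_next x.2).choose_spec.2.2.2
  exact ⟨k + 1, k.succ_pos, Subtype.ext hk⟩

theorem next_injective : Function.Injective (next hE) := fun x y h =>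
  (Function.bijOn_periodicPts (next hE)).injOn (mem_periodicPts_next hE x)
    (mem_periodicPts_next hE y) h

variable (K)

/-- The product of the `k` edges that follow a cyclic vertex. -/
noncomputable def cyclePath : ℕ → {x // E.IsCyclic x} → LeavittPathAlgebra K E
  | 0, x => vertex x.1
  | k + 1, x => edge (nextEdge hE x) * cyclePath k (next hE x)

/-- The product, in the reverse order, of the ghost edges of the `k` edges that follow a
cyclic vertex. -/
noncomputable def cycleGhost : ℕ → {x // E.IsCyclic x} → LeavittPathAlgebra K E
  | 0, x => vertex x.1
  | k + 1, x => cycleGhost k (next hE x) * ghost (nextEdge hE x)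

theorem isPathPair_cycle (k : ℕ) (x : {x // E.IsCyclic x}) :
    IsPathPair x.1 ((next hE)^[k] x).1 (cyclePath K hE k x) (cycleGhost K hE k x) := by
  induction k generalizing x with
  | zero => exact .nil _
  | succ k ih =>
    have := IsPathPair.cons (nextEdge hE x) (ih (next hE x))
    rwa [source_nextEdge] at this

variable {K} in
theorem IsPathPair.eq_cycle {x z : E.Vertex} {p q : LeavittPathAlgebra K E}
    (h : IsPathPair x z p q) (hx : E.IsCyclic x) :
    ∃ k, ((next hE)^[k] ⟨x, hx⟩).1 = z ∧ p = cyclePath K hE k ⟨x, hx⟩ ∧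
      q = cycleGhost K hE k ⟨x, hx⟩ := by
  induction h with
  | nil => exact ⟨0, rfl, rfl, rfl⟩
  | cons e h ih =>
    have he := eq_nextEdge hE (x := ⟨_, hx⟩) (e := e) rfl
    have hc : E.IsCyclic (E.range e) := he ▸ (next hE ⟨_, hx⟩).2
    have hn : next hE ⟨_, hx⟩ = ⟨E.range e, hc⟩ := Subtype.ext (congrArg E.range he.symm)
    obtain ⟨k, hk, hp, hq⟩ := ih hc
    refine ⟨k + 1, ?_, ?_, ?_⟩
    · rw [Function.iterate_succ_apply, hn, hk]
    · rw [cyclePath, hn, ← he, hp]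
    · rw [cycleGhost, hn, ← he, hq]

theorem cyclePath_add (k l : ℕ) (x : {x // E.IsCyclic x}) :
    cyclePath K hE (k + l) x = cyclePath K hE k x * cyclePath K hE l ((next hE)^[k] x) := by
  induction k generalizing x with
  | zero => rw [zero_add]; exact ((isPathPair_cycle K hE l x).vertex_mul_path).symm
  | succ k ih =>
    rw [Nat.succ_add, cyclePath, ih, cyclePath, mul_assoc, Function.iterate_succ_apply]

theorem cycleGhost_add (k l : ℕ) (x : {x // E.IsCyclic x}) :
    cycleGhost K hE (k + l) x = cycleGhost K hE l ((next hE)^[k] x) * cycleGhost K hE k x := by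
  induction k generalizing x with
  | zero => rw [zero_add]; exact ((isPathPair_cycle K hE l x).ghost_mul_vertex).symm
  | succ k ih =>
    rw [Nat.succ_add, cycleGhost, ih, cycleGhost, mul_assoc, Function.iterate_succ_apply]

/-- The relation `v = ∑ e e*` at a cyclic vertex has a single summand. -/
theorem nextEdge_mul_ghost (x : {x // E.IsCyclic x}) :
    (edge (nextEdge hE x) * ghost (nextEdge hE x) : LeavittPathAlgebra K E) = vertex x.1 := by
  have hset : {e : E.Edge | E.source e = x} = {nextEdge hE x} :=
    Set.eq_singleton_iff_unique_mem.2
      ⟨source_nextEdge hE x, fun e he => eq_nextEdge hE he⟩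
  have hfin : {e : E.Edge | E.source e = x}.Finite := hset ▸ Set.finite_singleton _
  have hT : hfin.toFinset = {nextEdge hE x} := by
    rw [← Finset.coe_inj, Set.Finite.coe_toFinset, hset, Finset.coe_singleton]
  rw [vertex_eq_sum x.1 hfin ⟨_, source_nextEdge hE x⟩, hT, Finset.sum_singleton]

theorem cyclePath_mul_cycleGhost (k : ℕ) (x : {x // E.IsCyclic x}) :
    cyclePath K hE k x * cycleGhost K hE k x = vertex x.1 := by
  induction k generalizing x with
  | zero => exact vertex_mul_self _
  | succ k ih =>
    rw [cyclePath, cycleGhost, mul_assoc, ← mul_assoc (cyclePath K hE k _), ih, next,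
      range_mul_ghost, nextEdge_mul_ghost]

open TensorProduct LaurentPolynomial in
/-- The corner at a cyclic vertex `x` of a no-exit graph is the ring of Laurent polynomials in the
cycle `c` based at `x`. It is spanned by the powers of `c`, which are invertible in the corner and
have distinct degrees in the grading of `L_K(E)`, so that they are linearly independent. -/
theorem hasPrincipalCorner_of_isCyclic (hE : E.IsNoExit) [Finite E.Vertex]
    (x : {x // E.IsCyclic x})
    (h0 : (vertex x.1 : LeavittPathAlgebra K E) ≠ 0) :
    HasPrincipalCorner.{w} (vertex x.1 : LeavittPathAlgebra K E) := by
  set n := Function.minimalPeriod (next hE) x with hn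
  have hn0 : 0 < n := Function.minimalPeriod_pos_of_mem_periodicPts (mem_periodicPts_next hE x)
  have hnx : (next hE)^[n] x = x := Function.iterate_minimalPeriod
  have hpair := isPathPair_cycle K hE n x
  have hlast := hpair.vertex_mul_ghost
  have hlast' : cyclePath K hE n x * vertex x.1 = cyclePath K hE n x := by
    have := cyclePath_add K hE n 0 x
    rw [add_zero, hnx] at this
    exact this.symm
  rw [hnx] at hpair hlast
  obtain ⟨ψ, hψ0, hψ1, hψ2⟩ := exists_zpowers_mulHom (vertex_mul_self x.1) hpair.vertex_mul_path
    hlast' hlast hpair.ghost_mul_vertex (cyclePath_mul_cycleGhost K hE n x) hpair.ghost_mul_path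
  have hψ_add : ∀ i j : ℤ, ψ (.ofAdd (i + j)) = ψ (.ofAdd i) * ψ (.ofAdd j) := fun i j => by
    rw [ofAdd_add, map_mul]
  let φ : K[T;T⁻¹] →ₙₐ[K] LeavittPathAlgebra K E := AddMonoidAlgebra.liftMagma K ψ
  have hφ : ∀ (i : ℤ) (k : K), φ (AddMonoidAlgebra.single i k) = k • ψ (.ofAdd i) := by
    intro i k
    simp [φ, -LaurentPolynomial.single_eq_C_mul_T]
  have hφ1 : φ 1 = vertex x.1 := by
    rw [AddMonoidAlgebra.one_def, hφ, one_smul, hψ0]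
  refine ⟨K[T;T⁻¹], inferInstance, inferInstance, LaurentPolynomial.isPrincipalIdealRing K,
    (φ : K[T;T⁻¹] →ₙ+* LeavittPathAlgebra K E), ?_, hφ1, fun a => ?_⟩
  · rw [injective_iff_map_eq_zero]
    intro f hf
    change φ f = 0 at hf
    obtain ⟨F, hFv, hFe, hFg⟩ := exists_grading (K := K) (E := E)
    have hFp : ∀ (k : ℕ) (y : {x // E.IsCyclic x}),
        F (cyclePath K hE k y) = T k ⊗ₜ cyclePath K hE k y ∧
          F (cycleGhost K hE k y) = T (-k) ⊗ₜ cycleGhost K hE k y := by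
      intro k
      induction k with
      | zero => exact fun y => ⟨hFv _, hFv _⟩
      | succ k ih =>
        intro y
        rw [cyclePath, cycleGhost, map_mul, map_mul, hFe, hFg, (ih _).1, (ih _).2,
          Algebra.TensorProduct.tmul_mul_tmul, Algebra.TensorProduct.tmul_mul_tmul, ← T_add,
          ← T_add, Nat.cast_succ, neg_add, add_comm 1]
        exact ⟨rfl, rfl⟩
    have hFψ : ∀ i : ℤ, F (ψ (.ofAdd i)) = T (n * i) ⊗ₜ ψ (.ofAdd i) := by
      intro i
      induction i using Int.induction_on with
      | zero => rw [hψ0, hFv, mul_zero]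
      | succ i ih =>
        rw [hψ_add, map_mul, ih, hψ1, (hFp n x).1, Algebra.TensorProduct.tmul_mul_tmul, ← T_add,
          mul_add, mul_one]
      | pred i ih =>
        rw [sub_eq_add_neg, hψ_add, map_mul, ih, hψ2, (hFp n x).2,
          Algebra.TensorProduct.tmul_mul_tmul, ← T_add, mul_add, mul_neg_one]
    -- The homogeneous component of degree `n * j`, as a linear map.
    let G : ℤ → LeavittPathAlgebra K E → LeavittPathAlgebra K E := fun j a =>
      TensorProduct.lid K _ (LinearMap.rTensor _
        ((Finsupp.lapply ((n : ℤ) * j)) ∘ₗ (AddMonoidAlgebra.coeffLinearEquiv K).toLinearMap :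
          K[T;T⁻¹] →ₗ[K] K) (F a))
    have hG_add : ∀ j a b, G j (a + b) = G j a + G j b := fun j a b => by
      simp only [G, map_add]
    have hG_smul : ∀ j (k : K) a, G j (k • a) = k • G j a := fun j k a => by
      simp only [G, map_smul]
    have hG_zero : ∀ j, G j 0 = 0 := fun j => by simp only [G, map_zero]
    have hGψ : ∀ i j, G j (ψ (.ofAdd i)) = if i = j then ψ (.ofAdd i) else 0 := by
      intro i j
      have hij : (n : ℤ) * i = n * j ↔ i = j :=
        mul_right_inj' (Int.natCast_ne_zero.2 hn0.ne')
      simp only [G, hFψ, LinearMap.rTensor_tmul, TensorProduct.lid_tmul, LinearMap.comp_apply]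
      change (AddMonoidAlgebra.coeff (T (n * i) : K[T;T⁻¹]) (n * j)) • _ = _
      rw [T, AddMonoidAlgebra.coeff_single, Finsupp.single_apply]
      simp only [hij]
      split_ifs <;> simp
    have hGφ : ∀ (f : K[T;T⁻¹]) j, G j (φ f) = f.coeff j • ψ (.ofAdd j) := by
      intro f j
      induction f using AddMonoidAlgebra.induction_linear with
      | zero => simp [hG_zero]
      | add f g hf hg => rw [map_add, hG_add, hf, hg, AddMonoidAlgebra.coeff_add,
          Finsupp.add_apply, add_smul]
      | single i k =>
        rw [hφ, hG_smul, hGψ, AddMonoidAlgebra.coeff_single, Finsupp.single_apply]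
        split_ifs with h
        · rw [h]
        · simp
    refine LaurentPolynomial.ext fun j => ?_
    have h1 := hGφ f j
    rw [hf, hG_zero] at h1
    -- A unit of the nonzero corner is nonzero.
    have h2 : ψ (.ofAdd j) ≠ 0 := by
      intro h
      apply h0
      rw [← hψ0, ← add_neg_cancel j, hψ_add, h, zero_mul]
    exact (smul_eq_zero.1 h1.symm).resolve_right h2
  · have hpow : ∀ j : ℕ, cyclePath K hE (n * j) x = ψ (.ofAdd (j : ℤ)) ∧
        cycleGhost K hE (n * j) x = ψ (.ofAdd (-j : ℤ)) := by
      intro j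
      induction j with
      | zero => exact ⟨hψ0.symm, hψ0.symm⟩
      | succ j ih =>
        rw [Nat.mul_succ, add_comm (n * j), cyclePath_add, cycleGhost_add, hnx, ih.1, ih.2,
          Nat.cast_succ, neg_add, hψ_add, hψ_add, ← hψ1, ← hψ2, ← hψ_add, ← hψ_add, ← hψ_add,
          add_comm (1 : ℤ)]
        exact ⟨rfl, rfl⟩
    have hmem : ∀ i : ℤ, ψ (.ofAdd i) ∈ LinearMap.range (φ : K[T;T⁻¹] →ₗ[K] _) := fun i =>
      ⟨AddMonoidAlgebra.single i 1, by
        change φ _ = _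
        rw [hφ, one_smul]⟩
    have hdvd : ∀ m l : ℕ, (next hE)^[l + m] x = (next hE)^[l] x → n ∣ m := by
      intro m l h
      rw [Function.iterate_add_apply] at h
      exact Function.IsPeriodicPt.minimalPeriod_dvd ((next_injective hE).iterate l h)
    refine vertex_mul_mul_vertex_mem x.1 x.1 (LinearMap.range (φ : K[T;T⁻¹] →ₗ[K] _))
      (fun z p p' q q' hp hq => ?_) a
    -- Two paths from `x` to the same vertex have lengths that differ by a multiple of `n`, so that
    -- `p q*` cancels to a power of the cycle or of its inverse.
    obtain ⟨k, hk, rfl, -⟩ := hp.eq_cycle hE x.2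
    obtain ⟨l, hl, -, rfl⟩ := hq.eq_cycle hE x.2
    have hkl : (next hE)^[k] x = (next hE)^[l] x := Subtype.ext (hk.trans hl.symm)
    rcases le_total l k with h | h
    · obtain ⟨m, rfl⟩ := Nat.exists_eq_add_of_le h
      obtain ⟨j, rfl⟩ := hdvd m l hkl
      have hj : (next hE)^[n * j] x = x :=
        (Function.isPeriodicPt_minimalPeriod (next hE) x).mul_const j
      rw [add_comm, cyclePath_add, hj, mul_assoc, cyclePath_mul_cycleGhost, (hpow j).1, ← hψ0,
        ← hψ_add]
      exact hmem _
    · obtain ⟨m, rfl⟩ := Nat.exists_eq_add_of_le h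
      obtain ⟨j, rfl⟩ := hdvd m k hkl.symm
      have hj : (next hE)^[n * j] x = x :=
        (Function.isPeriodicPt_minimalPeriod (next hE) x).mul_const j
      rw [add_comm, cycleGhost_add, hj, ← mul_assoc, cyclePath_mul_cycleGhost, (hpow j).2, ← hψ0,
        ← hψ_add]
      exact hmem _

end Cycle

/-! ### The base vertices -/

/-- Distinct base vertices reach no common vertex, so their corners are orthogonal. -/
theorem base_mul_mul_base (hE : E.IsNoExit) [Finite E.Vertex] {x y : E.Vertex} (hx : IsBase x)
    (hy : IsBase y) (hxy : x ≠ y) (a : LeavittPathAlgebra K E) : vertex x * a * vertex y = 0 :=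
  (Submodule.mem_bot K).1 <| vertex_mul_mul_vertex_mem x y ⊥
    (fun _ _ _ _ _ hp hq => (hxy (hE.base_eq hx hy hp.reach hq.reach)).elim) a

/-- The base vertices generate `L_K(E)` as an ideal. -/
theorem vertex_mem_iSup_base (hE : E.IsNoExit) [Finite E.Vertex] [Finite E.Edge] (x : E.Vertex) :
    (vertex x : LeavittPathAlgebra K E) ∈
      ⨆ y : {y : E.Vertex // IsBase y ∧ (vertex y : LeavittPathAlgebra K E) ≠ 0},
        Submodule.span ℤ {c | ∃ a b : LeavittPathAlgebra K E, c = a * vertex y.1 * b} := by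
  induction x using hE.induction_on_base with
  | hbase x hx =>
    by_cases h0 : (vertex x : LeavittPathAlgebra K E) = 0
    · rw [h0]; exact zero_mem _
    · refine Submodule.mem_iSup_of_mem ⟨x, hx, h0⟩ (Submodule.subset_span ⟨vertex x, vertex x, ?_⟩)
      rw [vertex_mul_self, vertex_mul_self]
  | hstep x hs ih =>
    have hne : {e : E.Edge | E.source e = x}.Nonempty := by
      by_contra h
      exact hs fun e he => h ⟨e, he⟩
    rw [vertex_eq_sum x (Set.toFinite _) hne]
    refine sum_mem fun e he => ?_
    rw [← edge_mul_range e]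
    let M : LeavittPathAlgebra K E →ₗ[ℤ] LeavittPathAlgebra K E :=
      ((AddMonoidHom.mulRight (ghost e)).comp (AddMonoidHom.mulLeft (edge e))).toIntLinearMap
    have hM : (⨆ y : {y : E.Vertex // IsBase y ∧ (vertex y : LeavittPathAlgebra K E) ≠ 0},
        Submodule.span ℤ {c | ∃ a b : LeavittPathAlgebra K E, c = a * vertex y.1 * b}) ≤
        (⨆ y : {y : E.Vertex // IsBase y ∧ (vertex y : LeavittPathAlgebra K E) ≠ 0},
        Submodule.span ℤ {c | ∃ a b : LeavittPathAlgebra K E, c = a * vertex y.1 * b}).comap M := by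
      refine iSup_le fun y => Submodule.span_le.2 ?_
      rintro _ ⟨a, b, rfl⟩
      refine Submodule.mem_iSup_of_mem y (Submodule.subset_span ⟨edge e * a, b * ghost e, ?_⟩)
      change edge e * (a * vertex y.1 * b) * ghost e = _
      simp only [mul_assoc]
    exact hM (ih e (by simpa using he))

end LeavittPathAlgebra

open LeavittPathAlgebra in
theorem mainTheorem12 (K : Type w) [Field K] (E : DirectedMultigraph.{u, v})
    (hfin : E.IsFinite) (hne : E.IsNoExit) : IsBaerRing (LeavittPathAlgebra K E) := by
  obtain ⟨_, _⟩ := hfin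
  have := Fintype.ofFinite E.Vertex
  refine IsBaerRing.of_principalCorners.{w} (ι := {y : E.Vertex // DirectedMultigraph.IsBase y ∧
    (vertex y : LeavittPathAlgebra K E) ≠ 0}) (fun y => vertex y.1) (fun y => ?_)
    (fun y z hyz a => base_mul_mul_base hne y.2.1 z.2.1 (fun h => hyz (Subtype.ext h)) a)
    (∑ x, vertex x) sum_vertex_mul mul_sum_vertex
    (sum_mem fun x _ => vertex_mem_iSup_base hne x)
  rcases y.2.1.1 with h | h
  · exact hasPrincipalCorner_of_isSink h y.2.2
  · exact hasPrincipalCorner_of_isCyclic K hne ⟨y.1, h⟩ y.2.2
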